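/- Let $(\Omega,\mathcal F,\mathbb P)$ be an atomless probability space, $n\ge 2$ and $\alpha\in(0,1)$; almost surely equal random variables are identified. For $\beta\in(0,1)$ put $\mathrm{VaR}_\beta(X)=\inf\{x\in\mathbb R:\mathbb P(X\le x)\ge 1-\beta\}$ for $X\in L^0$ and $\mathrm{ES}_\beta(X)=\frac1\beta\int_0^\beta \mathrm{VaR}_\gamma(X)\,d\gamma$ for $X\in L^1$. For $\rho\in\{\mathrm{VaR},\mathrm{ES}\}$ and $\mathbf X=(X_1,\dots,X_n)\in\mathcal X^n$, where $\mathcal X=L^0$ for $\mathrm{VaR}$ and $\mathcal X=L^1$ for $\mathrm{ES}$, define $$\mathrm{DQ}^\rho_\alpha(\mathbf X)=\frac{\alpha^*}{\alpha},\qquad \alpha^*=\inf\Big\{\beta\in(0,1):\rho_\beta\Big(\sum_{i=1}^n X_i\Big)\le\sum_{i=1}^n\rho_\alpha(X_i)\Big\},\qquad \inf\varnothing=1.$$ A tail event of $X$ is an event $A$ with $0<\mathbb P(A)<1$ such that $X(\omega)\ge X(\omega')$ for a.s. all $\omega\in A$, $\omega'\in A^c$; $\mathbf X$ is $\alpha$-concentrated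 if $X_1,\dots,X_n$ have a common tail event of probability $\alpha$. For $\alpha<1/n$, $\mathbf X$ has an $\alpha$-CE (concentration-exclusion) model if for each $i$, $\mathbb P(X_i>\mathrm{VaR}_\alpha(X_i))=\alpha$ and $\mathbb P(X_i\ge\mathrm{VaR}_\alpha(X_i))\ge n\alpha$, the events $\{X_i>\mathrm{VaR}_\alpha(X_i)\}$, $i=1,\dots,n$, are (a.s.) mutually exclusive, and $\mathbf X$ is $(n\alpha)$-concentrated. The class $\rho$ is non-flat from the left at $(\alpha,Y)$ if $\rho_\beta(Y)>\rho_\alpha(Y)$ for all $\beta\in(0,\alpha)$, and left continuous at $(\alpha,Y)$ if $\beta\mapsto\rho_\beta(Y)$ is left continuous at $\alpha$. Then the following hold. (i) $\{\mathrm{DQ}^{\mathrm{VaR}}_\alpha(\mathbf X):\mathbf X\in (L^0)^n\}=[0,\min\{n,1/\alpha\}]$ and $\{\mathrm{DQ}^{\mathrm{ES}}_\alpha(\mathbf X):\mathbf X\in (L^1)^n\}=[0,1]$. (ii) For $\rho$ being $\mathrm{VaR}$ or $\mathrm{ES}$, $\mathrm{DQ}^\rho_\alpha(\mathbf X)=0$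 if and only if $\sum_{i=1}^n X_i\le\sum_{i=1}^n\rho_\alpha(X_i)$ a.s. If $\sum_{i=1}^n X_i$ is a.s. constant, then $\mathrm{DQ}^{\mathrm{VaR}}_\alpha(\mathbf X)=0$ provided $\alpha<1/n$, and $\mathrm{DQ}^{\mathrm{ES}}_\alpha(\mathbf X)=0$. (iii) For $\rho$ being $\mathrm{VaR}$ or $\mathrm{ES}$, if $\mathbf X$ is $\alpha$-concentrated, then $\mathrm{DQ}^\rho_\alpha(\mathbf X)\le 1$. If, in addition, $\rho$ is left continuous and non-flat from the left at $(\alpha,\sum_{i=1}^n X_i)$, then $\mathrm{DQ}^\rho_\alpha(\mathbf X)=1$. (iv) If $\alpha<1/n$ and $\mathbf X\in (L^0)^n$ has an $\alpha$-CE model, then $\mathrm{DQ}^{\mathrm{VaR}}_\alpha(\mathbf X)=n$. If moreover $\mathbf X\in (L^1)^n$ and $\sum_{i=1}^n X_i$ is not a.s. constant on the event $\{\sum_{i=1}^n X_i>\sum_{i=1}^n\mathrm{VaR}_\alpha(X_i)\}$, then $\mathrm{DQ}^{\mathrm{ES}}_{n\alpha}(\mathbf X)=1$. -/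

import Mathlib

open MeasureTheory

noncomputable section

namespace Risk

variable {Ω : Type*} [MeasurableSpace Ω]

/-- An atomless measure: every measurable set of positive measure has a measurable subset
of strictly smaller positive measure. -/
def Atomless (P : Measure Ω) : Prop :=
  ∀ A : Set Ω, MeasurableSet A → 0 < P A →
    ∃ B : Set Ω, MeasurableSet B ∧ B ⊆ A ∧ 0 < P B ∧ P B < P A

/-- Value-at-Risk of the loss `X` at level `β ∈ (0,1)` ("small level" convention). For such `β`
the set below is non-empty and bounded below. -/
def VaR (P : Measure Ω) (β : ℝ) (X : Ω → ℝ) : ℝ :=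
  sInf {x : ℝ | 1 - β ≤ P.real {ω | X ω ≤ x}}

/-- Expected Shortfall of the (integrable) loss `X` at level `β ∈ (0,1)`. -/
def ES (P : Measure Ω) (β : ℝ) (X : Ω → ℝ) : ℝ :=
  1 / β * ∫ γ in (0 : ℝ)..β, VaR P γ X

/-- The total loss of the portfolio `X`. -/
def total {n : ℕ} (X : Fin n → Ω → ℝ) : Ω → ℝ := fun ω => ∑ i, X i ω

/-- The levels `β ∈ (0,1)` with `ρ_β(∑ X_i) ≤ ∑ ρ_α(X_i)`. -/
def admissibleLevels (ρ : ℝ → (Ω → ℝ) → ℝ) (α : ℝ) {n : ℕ} (X : Fin n → Ω → ℝ) : Set ℝ :=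
  {β : ℝ | 0 < β ∧ β < 1 ∧ ρ β (total X) ≤ ∑ i, ρ α (X i)}

open Classical in
/-- `α*`: the infimum of the admissible levels, with the convention `inf ∅ = 1`. -/
def alphaStar (ρ : ℝ → (Ω → ℝ) → ℝ) (α : ℝ) {n : ℕ} (X : Fin n → Ω → ℝ) : ℝ :=
  if (admissibleLevels ρ α X).Nonempty then sInf (admissibleLevels ρ α X) else 1

/-- The diversification quotient at level `α` based on a class `ρ` of risk measures indexed by
the interval `(0,1)`. -/
def DQ (ρ : ℝ → (Ω → ℝ) → ℝ) (α : ℝ) {n : ℕ} (X : Fin n → Ω → ℝ) : ℝ :=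
  alphaStar ρ α X / α

/-- `A` is a tail event of `X`: an event with `0 < P A < 1` such that `X ω ≥ X ω'` for
almost all `ω ∈ A` and `ω' ∉ A`. -/
def IsTailEvent (P : Measure Ω) (X : Ω → ℝ) (A : Set Ω) : Prop :=
  MeasurableSet A ∧ 0 < P.real A ∧ P.real A < 1 ∧
    ∀ᵐ ω ∂P, ∀ᵐ ω' ∂P, ω ∈ A → ω' ∉ A → X ω' ≤ X ω

/-- The components of `X` share a common tail event of probability `α`. -/
def Concentrated (P : Measure Ω) (α : ℝ) {n : ℕ} (X : Fin n → Ω → ℝ) : Prop :=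
  ∃ A : Set Ω, P.real A = α ∧ ∀ i, IsTailEvent P (X i) A

/-- The `α`-concentration-exclusion model. -/
structure IsCE (P : Measure Ω) (α : ℝ) {n : ℕ} (X : Fin n → Ω → ℝ) : Prop where
  prob_gt : ∀ i, P.real {ω | VaR P α (X i) < X i ω} = α
  prob_ge : ∀ i, n * α ≤ P.real {ω | VaR P α (X i) ≤ X i ω}
  exclusive : ∀ i j, i ≠ j →
    P ({ω | VaR P α (X i) < X i ω} ∩ {ω | VaR P α (X j) < X j ω}) = 0
  concentrated : Concentrated P (n * α) X

/-- The class `ρ` is non-flat from the left at `(α, Y)`. -/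
def NonFlatLeft (ρ : ℝ → (Ω → ℝ) → ℝ) (α : ℝ) (Y : Ω → ℝ) : Prop :=
  ∀ β : ℝ, 0 < β → β < α → ρ α Y < ρ β Y

/-- The class `ρ` is left continuous at `(α, Y)`. -/
def LeftCont (ρ : ℝ → (Ω → ℝ) → ℝ) (α : ℝ) (Y : Ω → ℝ) : Prop :=
  ContinuousWithinAt (fun β => ρ β Y) (Set.Iic α) α

end Risk

end

open Risk

/-!
Two formulas carry everything.

For `VaR`, the quantile has the Galois property `VaR_β(Y) ≤ t ↔ P(Y > t) ≤ β` (`VaR_le_iff`), so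
the level `α*` is *equal* to the probability `P(∑ X_i > ∑ VaR_α(X_i))` (`alphaStar_VaR_eq`). The
claims on `VaR` thereby become statements on one event, which is contained in the union of the
`n` events `{X_i > VaR_α(X_i)}`, each of probability at most `α`. Indicators of disjoint events
realise every value; such events exist by Sierpiński's theorem (`Atomless.exists_subset_eq`).

For `ES`, the function `γ ↦ VaR_γ(Y)` on `(0, 1)` has the law of `Y` (`map_VaR_eq`), which gives
the Rockafellar–Uryasev formula `β ES_β(Y) = min_x (β x + E (Y - x)⁺)`, attained at
`x = VaR_β(Y)` (`mul_ES_le`, `mul_ES_eq_VaR_add`). It yields subadditivity (`ES_total_le`), hence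
`DQ ≤ 1`, and shows that `ES` at level `P(A)` is the average loss over a tail event `A`
(`IsTailEvent.mul_ES_eq`), hence that `ES` is additive over a common tail event.

A tail event is nested with every upper level set, up to null sets (`IsTailEvent.ae_or`). So
comparing probabilities decides which one contains the other; this is how the concentration
hypotheses are used. In a concentration-exclusion model the `n` exclusive events
`{X_i > VaR_α(X_i)}` fill the common tail event, on which no component is below its quantile, so
the union bound is an equality. If `ES` of the total loss were flat to the left of `n α`, the total
loss would be constant on that tail event (`IsTailEvent.ae_eq_of_ES_le`).
-/

namespace Risk

open ProbabilityTheory Filter Topology Set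

/-! ### Quantiles and Expected Shortfall -/

theorem mul_ES_eq {Ω : Type*} [MeasurableSpace Ω] {P : Measure Ω} {X : Ω → ℝ} {β : ℝ}
    (hβ0 : 0 < β) :
    β * ES P β X = ∫ γ in Ioc (0 : ℝ) β, VaR P γ X := by
  rw [ES, ← mul_assoc, mul_one_div_cancel hβ0.ne', one_mul, intervalIntegral.integral_of_le hβ0.le]

section Quantile

variable {Ω : Type*} [MeasurableSpace Ω] {P : Measure Ω} [IsProbabilityMeasure P] {X : Ω → ℝ}

theorem cdf_map_eq (hX : AEMeasurable X P) (x : ℝ) :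
    cdf (P.map X) x = P.real {ω | X ω ≤ x} := by
  have := Measure.isProbabilityMeasure_map hX
  rw [cdf_eq_real, map_measureReal_apply_of_aemeasurable hX measurableSet_Iic]
  rfl

theorem VaR_le_iff_le (hX : AEMeasurable X P) {β : ℝ} (hβ0 : 0 < β) (hβ1 : β < 1) {x : ℝ} :
    VaR P β X ≤ x ↔ 1 - β ≤ P.real {ω | X ω ≤ x} := by
  have hset : {x : ℝ | 1 - β ≤ P.real {ω | X ω ≤ x}} = {x | 1 - β ≤ cdf (P.map X) x} := by
    simp only [cdf_map_eq hX]
  have hne : {x | 1 - β ≤ cdf (P.map X) x}.Nonempty :=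
    ((tendsto_cdf_atTop (P.map X)).eventually (eventually_ge_nhds (by linarith))).exists
  have hbdd : BddBelow {x | 1 - β ≤ cdf (P.map X) x} := by
    obtain ⟨m, hm⟩ := ((tendsto_cdf_atBot (P.map X)).eventually
      (eventually_lt_nhds (show (0 : ℝ) < 1 - β by linarith))).exists
    refine ⟨m, fun y hy => ?_⟩
    by_contra! h
    exact absurd ((monotone_cdf (P.map X) h.le).trans_lt hm) (not_lt.2 hy)
  rw [VaR, hset, ← cdf_map_eq hX]
  refine ⟨fun h => le_trans ?_ (monotone_cdf _ h), fun h => csInf_le hbdd h⟩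
  refine ge_of_tendsto (((cdf (P.map X)).right_continuous _).mono Ioi_subset_Ici_self) ?_
  filter_upwards [self_mem_nhdsWithin] with y hy
  obtain ⟨a, ha, hay⟩ := exists_lt_of_csInf_lt hne hy
  exact le_trans ha (monotone_cdf _ hay.le)

theorem measureReal_gt_eq (hX : AEMeasurable X P) (x : ℝ) :
    P.real {ω | x < X ω} = 1 - P.real {ω | X ω ≤ x} := by
  rw [← probReal_compl_eq_one_sub₀ (nullMeasurableSet_le hX aemeasurable_const)]
  congr 1
  ext ω
  simp

/-- The Galois property of the quantile: `VaR` is at most `x` exactly when the probability of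
exceeding `x` is at most the level. -/
theorem VaR_le_iff (hX : AEMeasurable X P) {β : ℝ} (hβ0 : 0 < β) (hβ1 : β < 1) {x : ℝ} :
    VaR P β X ≤ x ↔ P.real {ω | x < X ω} ≤ β := by
  rw [VaR_le_iff_le hX hβ0 hβ1, measureReal_gt_eq hX]
  constructor <;> intro h <;> linarith

theorem measureReal_VaR_lt (hX : AEMeasurable X P) {β : ℝ} (hβ0 : 0 < β) (hβ1 : β < 1) :
    P.real {ω | VaR P β X < X ω} ≤ β :=
  (VaR_le_iff hX hβ0 hβ1).1 le_rfl

theorem antitoneOn_VaR (hX : AEMeasurable X P) :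
    AntitoneOn (fun γ => VaR P γ X) (Ioo 0 1) := fun _ ha _ hb hab =>
  (VaR_le_iff hX hb.1 hb.2).2 ((measureReal_VaR_lt hX ha.1 ha.2).trans hab)

theorem aemeasurable_VaR (hX : AEMeasurable X P) :
    AEMeasurable (fun γ => VaR P γ X) (volume.restrict (Ioo (0 : ℝ) 1)) :=
  aemeasurable_restrict_of_antitoneOn measurableSet_Ioo (antitoneOn_VaR hX)

/-- The quantile transform: under Lebesgue measure on `(0, 1)` the function `γ ↦ VaR_γ X` has
the law of `X`. -/
theorem map_VaR_eq (hX : AEMeasurable X P) :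
    (volume.restrict (Ioo (0 : ℝ) 1)).map (fun γ => VaR P γ X) = P.map X := by
  have := Measure.isProbabilityMeasure_map hX
  refine (Measure.ext_of_Iic (P.map X) _ fun x => ?_).symm
  have hp1 : P.real {ω | x < X ω} = 1 - P.real {ω | X ω ≤ x} := measureReal_gt_eq hX x
  set p := P.real {ω | x < X ω} with hp
  have hp0 : 0 ≤ p := measureReal_nonneg
  rw [Measure.map_apply_of_aemeasurable hX measurableSet_Iic,
    Measure.map_apply_of_aemeasurable (aemeasurable_VaR hX) measurableSet_Iic,
    Measure.restrict_apply' measurableSet_Ioo]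
  have hval : P (X ⁻¹' Iic x) = ENNReal.ofReal (1 - p) := by
    rw [hp1, sub_sub_cancel]
    exact (ofReal_measureReal (measure_ne_top _ _)).symm
  rw [hval]
  refine le_antisymm ?_ ?_
  · rw [← Real.volume_Ioo]
    refine measure_mono fun γ hγ => ?_
    have h0 : 0 < γ := hp0.trans_lt hγ.1
    exact ⟨(VaR_le_iff hX h0 hγ.2).2 hγ.1.le, h0, hγ.2⟩
  · rw [← Real.volume_Icc]
    refine measure_mono fun γ hγ => ?_
    exact ⟨(VaR_le_iff hX hγ.2.1 hγ.2.2).1 hγ.1, hγ.2.2.le⟩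

theorem integrableOn_VaR (hX : Integrable X P) :
    IntegrableOn (fun γ => VaR P γ X) (Ioo (0 : ℝ) 1) := by
  have h : Integrable id (P.map X) :=
    (integrable_map_measure aestronglyMeasurable_id hX.aemeasurable).2 hX
  rw [← map_VaR_eq hX.aemeasurable] at h
  exact (integrable_map_measure aestronglyMeasurable_id (aemeasurable_VaR hX.aemeasurable)).1 h

theorem setIntegral_max_VaR (hX : Integrable X P) (x : ℝ) :
    ∫ γ in Ioo (0 : ℝ) 1, max (VaR P γ X - x) 0 = ∫ ω, max (X ω - x) 0 ∂P := by
  have hf : Continuous fun y : ℝ => max (y - x) 0 := by fun_prop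
  rw [← integral_map (f := fun y : ℝ => max (y - x) 0) hX.aemeasurable hf.aestronglyMeasurable,
    ← map_VaR_eq hX.aemeasurable,
    integral_map (aemeasurable_VaR hX.aemeasurable) hf.aestronglyMeasurable]

theorem integrable_max_sub (hX : Integrable X P) (x : ℝ) :
    Integrable (fun ω => max (X ω - x) 0) P :=
  (hX.sub (integrable_const x)).pos_part

theorem Ioc_subset_Ioo_zero_one {β : ℝ} (hβ1 : β < 1) : Ioc (0 : ℝ) β ⊆ Ioo 0 1 :=
  fun _ h => ⟨h.1, h.2.trans_lt hβ1⟩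

theorem setIntegral_VaR_sub (hX : Integrable X P) {β : ℝ} (hβ0 : 0 < β) (hβ1 : β < 1) (x : ℝ) :
    ∫ γ in Ioc (0 : ℝ) β, (VaR P γ X - x) = β * ES P β X - β * x := by
  have h := (integrableOn_VaR hX).mono_set (Ioc_subset_Ioo_zero_one hβ1)
  rw [integral_sub h (integrable_const x), ← mul_ES_eq hβ0]
  simp [hβ0.le]

/-- The bound half of the Rockafellar–Uryasev formula. -/
theorem mul_ES_le (hX : Integrable X P) {β : ℝ} (hβ0 : 0 < β) (hβ1 : β < 1) (x : ℝ) :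
    β * ES P β X ≤ β * x + ∫ ω, max (X ω - x) 0 ∂P := by
  have hsub := Ioc_subset_Ioo_zero_one hβ1
  have hI := integrableOn_VaR hX
  have hm : IntegrableOn (fun γ => max (VaR P γ X - x) 0) (Ioo (0 : ℝ) 1) :=
    (hI.sub (integrable_const x)).pos_part
  have h1 : ∫ γ in Ioc (0 : ℝ) β, (VaR P γ X - x) ≤
      ∫ γ in Ioc (0 : ℝ) β, max (VaR P γ X - x) 0 :=
    integral_mono ((hI.mono_set hsub).sub (integrable_const x)) (hm.mono_set hsub)
      fun γ => le_max_left _ _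
  have h2 : ∫ γ in Ioc (0 : ℝ) β, max (VaR P γ X - x) 0 ≤
      ∫ γ in Ioo (0 : ℝ) 1, max (VaR P γ X - x) 0 :=
    setIntegral_mono_set hm (ae_of_all _ fun γ => le_max_right _ _)
      (LE.le.eventuallyLE hsub)
  rw [setIntegral_VaR_sub hX hβ0 hβ1] at h1
  rw [setIntegral_max_VaR hX] at h2
  linarith

/-- The bound `mul_ES_le` is attained at the quantile. -/
theorem mul_ES_eq_VaR_add (hX : Integrable X P) {β : ℝ} (hβ0 : 0 < β) (hβ1 : β < 1) :
    β * ES P β X = β * VaR P β X + ∫ ω, max (X ω - VaR P β X) 0 ∂P := by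
  have hanti := antitoneOn_VaR hX.aemeasurable
  rw [← setIntegral_max_VaR hX, ← sub_eq_iff_eq_add', ← setIntegral_VaR_sub hX hβ0 hβ1]
  have hsub := Ioc_subset_Ioo_zero_one hβ1
  rw [setIntegral_eq_of_subset_of_forall_sdiff_eq_zero measurableSet_Ioo hsub]
  · refine setIntegral_congr_fun measurableSet_Ioc fun γ hγ => ?_
    exact (max_eq_left (sub_nonneg.2 (hanti (hsub hγ) ⟨hβ0, hβ1⟩ hγ.2))).symm
  · intro γ hγ
    have hlt : β ≤ γ := by
      by_contra! h
      exact hγ.2 ⟨hγ.1.1, h.le⟩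
    exact max_eq_right (sub_nonpos.2 (hanti ⟨hβ0, hβ1⟩ hγ.1 hlt))

theorem VaR_le_ES (hX : Integrable X P) {β : ℝ} (hβ0 : 0 < β) (hβ1 : β < 1) :
    VaR P β X ≤ ES P β X := by
  refine le_of_mul_le_mul_left ?_ hβ0
  rw [mul_ES_eq_VaR_add hX hβ0 hβ1]
  exact le_add_of_nonneg_right (integral_nonneg fun ω => le_max_right _ _)

theorem ES_le_of_ae_le (hX : Integrable X P) {β : ℝ} (hβ0 : 0 < β) (hβ1 : β < 1) {c : ℝ}
    (h : ∀ᵐ ω ∂P, X ω ≤ c) : ES P β X ≤ c := by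
  refine le_of_mul_le_mul_left ((mul_ES_le hX hβ0 hβ1 c).trans_eq ?_) hβ0
  rw [integral_eq_zero_of_ae, add_zero]
  filter_upwards [h] with ω hω
  exact max_eq_right (sub_nonpos.2 hω)

end Quantile

/-! ### Atomless measures -/

section Atomless

variable {Ω : Type*} [MeasurableSpace Ω] {P : Measure Ω} [IsProbabilityMeasure P]

theorem Atomless.exists_subset_le_half (hP : Atomless P) {A : Set Ω} (hA : MeasurableSet A)
    (hpos : 0 < P.real A) :
    ∃ B, MeasurableSet B ∧ B ⊆ A ∧ 0 < P.real B ∧ P.real B ≤ P.real A / 2 := by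
  obtain ⟨B, hB, hBA, hB0, hBlt⟩ := hP A hA (ENNReal.toReal_pos_iff.1 hpos).1
  have hB0' : 0 < P.real B := ENNReal.toReal_pos_iff.2 ⟨hB0, measure_lt_top _ _⟩
  have hBlt' : P.real B < P.real A := by
    rw [Measure.real, Measure.real]
    exact (ENNReal.toReal_lt_toReal (measure_ne_top _ _) (measure_ne_top _ _)).2 hBlt
  rcases le_total (P.real B) (P.real A / 2) with h | h
  · exact ⟨B, hB, hBA, hB0', h⟩
  · have hd : P.real (A \ B) = P.real A - P.real B := measureReal_sdiff hBA hB
    exact ⟨A \ B, hA.diff hB, sdiff_subset, by linarith, by linarith⟩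

theorem Atomless.exists_subset_small (hP : Atomless P) {A : Set Ω} (hA : MeasurableSet A)
    (hpos : 0 < P.real A) {ε : ℝ} (hε : 0 < ε) :
    ∃ B, MeasurableSet B ∧ B ⊆ A ∧ 0 < P.real B ∧ P.real B ≤ ε := by
  have key : ∀ k : ℕ, ∃ B, MeasurableSet B ∧ B ⊆ A ∧ 0 < P.real B ∧
      P.real B ≤ P.real A * (1 / 2) ^ k := by
    intro k
    induction k with
    | zero => exact ⟨A, hA, Subset.rfl, hpos, by simp⟩
    | succ k ih =>
      obtain ⟨B, hB, hBA, hB0, hBk⟩ := ih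
      obtain ⟨C, hC, hCB, hC0, hCk⟩ := hP.exists_subset_le_half hB hB0
      refine ⟨C, hC, hCB.trans hBA, hC0, ?_⟩
      rw [pow_succ]
      linarith
  obtain ⟨k, hk⟩ := exists_pow_lt_of_lt_one (div_pos hε hpos)
    (show (1 / 2 : ℝ) < 1 by norm_num)
  obtain ⟨B, hB, hBA, hB0, hBk⟩ := key k
  refine ⟨B, hB, hBA, hB0, hBk.trans ?_⟩
  rw [lt_div_iff₀ hpos] at hk
  linarith

/-- Sierpiński's theorem: an atomless measure takes every intermediate value on the measurable
subsets of a given set. A chain of subsets of measure at most `c` is built greedily, each one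
gaining at least half of the available increase; its union then has measure `c`. -/
theorem Atomless.exists_subset_eq (hP : Atomless P) {A : Set Ω} (hA : MeasurableSet A) {c : ℝ}
    (hc0 : 0 ≤ c) (hcA : c ≤ P.real A) :
    ∃ B, MeasurableSet B ∧ B ⊆ A ∧ P.real B = c := by
  let F : Set (Set Ω) := {B | MeasurableSet B ∧ B ⊆ A ∧ P.real B ≤ c}
  have step : ∀ B : F, ∃ B' : F, B.1 ⊆ B'.1 ∧
      ∀ C ∈ F, B.1 ⊆ C → P.real C ≤ 2 * P.real B'.1 - P.real B.1 := by
    intro B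
    let G : Set ℝ := P.real '' {C | C ∈ F ∧ B.1 ⊆ C}
    have hGne : G.Nonempty := ⟨_, B.1, ⟨B.2, Subset.rfl⟩, rfl⟩
    have hGbdd : BddAbove G := by
      refine ⟨c, ?_⟩
      rintro _ ⟨C, hC, rfl⟩
      exact hC.1.2.2
    have hle : ∀ C ∈ F, B.1 ⊆ C → P.real C ≤ sSup G := fun C hC hBC =>
      le_csSup hGbdd ⟨C, ⟨hC, hBC⟩, rfl⟩
    rcases (hle B B.2 Subset.rfl).eq_or_lt with h | h
    · refine ⟨B, Subset.rfl, fun C hC hBC => ?_⟩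
      have := hle C hC hBC
      linarith
    · obtain ⟨_, ⟨B', hB', rfl⟩, hlt⟩ :=
        exists_lt_of_lt_csSup hGne (show (P.real B.1 + sSup G) / 2 < sSup G by linarith)
      refine ⟨⟨B', hB'.1⟩, hB'.2, fun C hC hBC => ?_⟩
      have := hle C hC hBC
      change _ ≤ 2 * P.real B' - _
      linarith
  choose f hf_sub hf_le using step
  let B : ℕ → F := fun k => f^[k] ⟨∅, MeasurableSet.empty, empty_subset _, by simpa using hc0⟩
  have hBsucc : ∀ k, B (k + 1) = f (B k) := fun k => Function.iterate_succ_apply' _ _ _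
  have hmono : Monotone fun k => (B k).1 := by
    refine monotone_nat_of_le_succ fun k => ?_
    rw [hBsucc]
    exact hf_sub _
  let U : Set Ω := ⋃ k, (B k).1
  have hU : MeasurableSet U := MeasurableSet.iUnion fun k => (B k).2.1
  have hUA : U ⊆ A := iUnion_subset fun k => (B k).2.2.1
  have htend : Tendsto (fun k => P.real (B k).1) atTop (𝓝 (P.real U)) :=
    (ENNReal.tendsto_toReal (measure_ne_top P U)).comp (tendsto_measure_iUnion_atTop hmono)
  have hUc : P.real U ≤ c := le_of_tendsto' htend fun k => (B k).2.2.2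
  refine ⟨U, hU, hUA, hUc.antisymm ?_⟩
  by_contra! hlt
  have hd : P.real (A \ U) = P.real A - P.real U := measureReal_sdiff hUA hU
  obtain ⟨C, hC, hCA, hC0, hCle⟩ := hP.exists_subset_small (hA.diff hU)
    (show 0 < P.real (A \ U) by linarith) (sub_pos.2 hlt)
  have hUC : P.real (U ∪ C) = P.real U + P.real C :=
    measureReal_union (disjoint_sdiff_right.mono_right hCA) hC
  have hmem : U ∪ C ∈ F :=
    ⟨hU.union hC, union_subset hUA (hCA.trans sdiff_subset), by linarith⟩
  have hbound : ∀ k, P.real (U ∪ C) ≤ 2 * P.real (B (k + 1)).1 - P.real (B k).1 := by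
    intro k
    rw [hBsucc]
    exact hf_le _ _ hmem ((subset_iUnion (fun k => (B k).1) k).trans subset_union_left)
  have hlim := ge_of_tendsto' (((htend.comp (tendsto_add_atTop_nat 1)).const_mul 2).sub htend)
    hbound
  linarith

theorem Atomless.exists_pairwise_disjoint (hP : Atomless P) (n : ℕ) {A : Set Ω}
    (hA : MeasurableSet A) {q : ℝ} (hq : 0 ≤ q) (hnq : n * q ≤ P.real A) :
    ∃ B : Fin n → Set Ω, (∀ i, MeasurableSet (B i) ∧ B i ⊆ A ∧ P.real (B i) = q) ∧
      Pairwise (Function.onFun Disjoint B) := by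
  induction n generalizing A with
  | zero => exact ⟨fun _ => ∅, fun i => i.elim0, fun i => i.elim0⟩
  | succ n ih =>
    push_cast at hnq
    have hn : 0 ≤ n * q := by positivity
    obtain ⟨C, hC, hCA, hCq⟩ := hP.exists_subset_eq hA hq (by linarith)
    have hd : P.real (A \ C) = P.real A - P.real C := measureReal_sdiff hCA hC
    obtain ⟨B, hB, hdisj⟩ := ih (hA.diff hC) (by linarith)
    refine ⟨Fin.cons C B, ?_, ?_⟩
    · refine Fin.cases ⟨hC, hCA, hCq⟩ fun i => ?_
      exact ⟨(hB i).1, (hB i).2.1.trans sdiff_subset, (hB i).2.2⟩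
    · have hCB : ∀ i, Disjoint C (B i) := fun i => disjoint_sdiff_right.mono_right (hB i).2.1
      intro i j
      refine Fin.cases ?_ (fun i => ?_) i <;> refine Fin.cases ?_ (fun j => ?_) j <;> intro hij
      · exact absurd rfl hij
      · exact hCB j
      · exact (hCB i).symm
      · exact hdisj fun h => hij (congrArg Fin.succ h)

end Atomless

/-! ### The diversification quotient -/

section Quotient

variable {Ω : Type*} {ρ : ℝ → (Ω → ℝ) → ℝ} {α : ℝ} {n : ℕ} {X : Fin n → Ω → ℝ}

theorem bddBelow_admissibleLevels : BddBelow (admissibleLevels ρ α X) :=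
  ⟨0, fun _ h => h.1.le⟩

theorem alphaStar_le_of_mem {β : ℝ} (h : β ∈ admissibleLevels ρ α X) : alphaStar ρ α X ≤ β := by
  rw [alphaStar, if_pos ⟨β, h⟩]
  exact csInf_le bddBelow_admissibleLevels h

theorem le_alphaStar {a : ℝ} (ha : a ≤ 1) (h : ∀ β ∈ admissibleLevels ρ α X, a ≤ β) :
    a ≤ alphaStar ρ α X := by
  rw [alphaStar]
  split_ifs with hne
  · exact le_csInf hne h
  · exact ha

theorem alphaStar_nonneg : 0 ≤ alphaStar ρ α X :=
  le_alphaStar zero_le_one fun _ h => h.1.le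

theorem exists_mem_admissibleLevels_lt {a : ℝ} (ha : a ≤ 1) (h : alphaStar ρ α X < a) :
    ∃ β ∈ admissibleLevels ρ α X, β < a := by
  by_contra! hc
  exact absurd (le_alphaStar ha hc) (not_le.2 h)

theorem alphaStar_le_one : alphaStar ρ α X ≤ 1 := by
  rw [alphaStar]
  split_ifs with hne
  · obtain ⟨β, h⟩ := hne
    exact (csInf_le bddBelow_admissibleLevels h).trans h.2.1.le
  · exact le_rfl

theorem DQ_nonneg (hα0 : 0 < α) : 0 ≤ DQ ρ α X := div_nonneg alphaStar_nonneg hα0.le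

theorem DQ_eq_zero_iff (hα0 : 0 < α) : DQ ρ α X = 0 ↔ alphaStar ρ α X = 0 := by
  simp [DQ, hα0.ne']

theorem DQ_le_one_of_le (hα0 : 0 < α) (hα1 : α < 1)
    (h : ρ α (total X) ≤ ∑ i, ρ α (X i)) : DQ ρ α X ≤ 1 :=
  (div_le_one hα0).2 (alphaStar_le_of_mem ⟨hα0, hα1, h⟩)

/-- If `ρ_α` is additive on the portfolio then `α` is admissible, and non-flatness from the left
excludes every smaller level. -/
theorem DQ_eq_one_of_eq (hα0 : 0 < α) (hα1 : α < 1)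
    (h : ρ α (total X) = ∑ i, ρ α (X i)) (hflat : NonFlatLeft ρ α (total X)) :
    DQ ρ α X = 1 := by
  refine (DQ_le_one_of_le hα0 hα1 h.le).antisymm ((one_le_div hα0).2 ?_)
  refine le_alphaStar hα1.le fun β hβ => ?_
  by_contra! hlt
  have := hflat β hβ.1 hlt
  linarith [hβ.2.2]

end Quotient

/-! ### The total loss -/

section Total

variable {Ω : Type*} [MeasurableSpace Ω] {P : Measure Ω} {n : ℕ} {X : Fin n → Ω → ℝ}

theorem aemeasurable_total (hX : ∀ i, AEMeasurable (X i) P) : AEMeasurable (total X) P :=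
  Finset.univ.aemeasurable_fun_sum fun i _ => hX i

theorem integrable_total (hX : ∀ i, Integrable (X i) P) : Integrable (total X) P :=
  integrable_finsetSum _ fun i _ => hX i

variable [IsProbabilityMeasure P] {α : ℝ}

/-- The level `α*` based on `VaR` is the probability that the total loss exceeds the sum of the
individual quantiles. -/
theorem alphaStar_VaR_eq (hX : ∀ i, AEMeasurable (X i) P) :
    alphaStar (VaR P) α X = P.real {ω | ∑ i, VaR P α (X i) < total X ω} := by
  have hS := aemeasurable_total hX
  refine le_antisymm ?_ ?_
  · refine le_of_forall_gt_imp_ge_of_dense fun β hβ => ?_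
    rcases lt_or_ge β 1 with h1 | h1
    · have h0 : 0 < β := measureReal_nonneg.trans_lt hβ
      exact alphaStar_le_of_mem ⟨h0, h1, (VaR_le_iff hS h0 h1).2 hβ.le⟩
    · exact alphaStar_le_one.trans h1
  · exact le_alphaStar measureReal_le_one fun β hβ => (VaR_le_iff hS hβ.1 hβ.2.1).1 hβ.2.2

theorem measureReal_lt_total_le (hX : ∀ i, AEMeasurable (X i) P) (hα0 : 0 < α) (hα1 : α < 1) :
    P.real {ω | ∑ i, VaR P α (X i) < total X ω} ≤ n * α := by
  have hsub : {ω | ∑ i, VaR P α (X i) < total X ω} ⊆ ⋃ i, {ω | VaR P α (X i) < X i ω} := by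
    intro ω hω
    obtain ⟨i, -, hi⟩ := Finset.exists_lt_of_sum_lt (show _ < ∑ i, X i ω from hω)
    exact mem_iUnion.2 ⟨i, hi⟩
  calc _ ≤ P.real (⋃ i, {ω | VaR P α (X i) < X i ω}) := measureReal_mono hsub
    _ ≤ ∑ i, P.real {ω | VaR P α (X i) < X i ω} := measureReal_iUnion_fintype_le _
    _ ≤ ∑ _i : Fin n, α := Finset.sum_le_sum fun i _ => measureReal_VaR_lt (hX i) hα0 hα1
    _ = n * α := by simp

/-- Subadditivity of Expected Shortfall, read off from the Rockafellar–Uryasev formula since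
`(∑ X_i - ∑ x_i)⁺ ≤ ∑ (X_i - x_i)⁺`. -/
theorem ES_total_le (hX : ∀ i, Integrable (X i) P) (hα0 : 0 < α) (hα1 : α < 1) :
    ES P α (total X) ≤ ∑ i, ES P α (X i) := by
  refine le_of_mul_le_mul_left ?_ hα0
  have h1 := mul_ES_le (integrable_total hX) hα0 hα1 (∑ i, VaR P α (X i))
  have h2 : ∫ ω, max (total X ω - ∑ i, VaR P α (X i)) 0 ∂P ≤
      ∑ i, ∫ ω, max (X i ω - VaR P α (X i)) 0 ∂P := by
    rw [← integral_finsetSum _ fun i _ => integrable_max_sub (hX i) _]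
    refine integral_mono (integrable_max_sub (integrable_total hX) _)
      (integrable_finsetSum _ fun i _ => integrable_max_sub (hX i) _) fun ω => ?_
    refine max_le ?_ (Finset.sum_nonneg fun i _ => le_max_right _ _)
    rw [total, ← Finset.sum_sub_distrib]
    exact Finset.sum_le_sum fun i _ => le_max_left _ _
  have h3 : α * ∑ i, ES P α (X i) =
      α * ∑ i, VaR P α (X i) + ∑ i, ∫ ω, max (X i ω - VaR P α (X i)) 0 ∂P := by
    rw [Finset.mul_sum, Finset.mul_sum, ← Finset.sum_add_distrib]
    exact Finset.sum_congr rfl fun i _ => mul_ES_eq_VaR_add (hX i) hα0 hα1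
  linarith

theorem DQ_ES_le_one (hX : ∀ i, Integrable (X i) P) (hα0 : 0 < α) (hα1 : α < 1) :
    DQ (ES P) α X ≤ 1 :=
  DQ_le_one_of_le hα0 hα1 (ES_total_le hX hα0 hα1)

theorem DQ_VaR_le (hX : ∀ i, AEMeasurable (X i) P) (hα0 : 0 < α) (hα1 : α < 1) :
    DQ (VaR P) α X ≤ min (n : ℝ) (1 / α) := by
  refine le_min ?_ (div_le_div_of_nonneg_right alphaStar_le_one hα0.le)
  rw [DQ, div_le_iff₀ hα0, alphaStar_VaR_eq hX]
  exact measureReal_lt_total_le hX hα0 hα1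

theorem measureReal_lt_eq_zero_iff {Y : Ω → ℝ} {t : ℝ} :
    P.real {ω | t < Y ω} = 0 ↔ ∀ᵐ ω ∂P, Y ω ≤ t := by
  rw [measureReal_eq_zero_iff, ae_iff]
  simp only [not_le]

theorem DQ_VaR_eq_zero_iff (hX : ∀ i, AEMeasurable (X i) P) (hα0 : 0 < α) :
    DQ (VaR P) α X = 0 ↔ ∀ᵐ ω ∂P, total X ω ≤ ∑ i, VaR P α (X i) := by
  rw [DQ_eq_zero_iff hα0, alphaStar_VaR_eq hX, measureReal_lt_eq_zero_iff]

theorem DQ_ES_eq_zero_iff (hX : ∀ i, Integrable (X i) P) (hα0 : 0 < α) :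
    DQ (ES P) α X = 0 ↔ ∀ᵐ ω ∂P, total X ω ≤ ∑ i, ES P α (X i) := by
  have hS := integrable_total hX
  rw [DQ_eq_zero_iff hα0]
  refine ⟨fun h => ?_, fun h => le_antisymm ?_ alphaStar_nonneg⟩
  · rw [← measureReal_lt_eq_zero_iff]
    refine le_antisymm (le_of_forall_gt_imp_ge_of_dense fun ε hε => ?_) measureReal_nonneg
    obtain ⟨β, ⟨h0, h1, hβ⟩, hlt⟩ :=
      exists_mem_admissibleLevels_lt (min_le_right ε 1) (h.trans_lt (lt_min hε one_pos))
    exact ((VaR_le_iff hS.aemeasurable h0 h1).1 ((VaR_le_ES hS h0 h1).trans hβ)).trans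
      (hlt.le.trans (min_le_left _ _))
  · refine le_of_forall_gt_imp_ge_of_dense fun β hβ => ?_
    rcases lt_or_ge β 1 with h1 | h1
    · exact alphaStar_le_of_mem ⟨hβ, h1, ES_le_of_ae_le hS hβ h1 h⟩
    · exact alphaStar_le_one.trans h1

theorem DQ_VaR_eq_zero_of_const (hX : ∀ i, AEMeasurable (X i) P) (hα0 : 0 < α) (hα1 : α < 1)
    (hn : n * α < 1) {c : ℝ} (hc : ∀ᵐ ω ∂P, total X ω = c) : DQ (VaR P) α X = 0 := by
  rw [DQ_VaR_eq_zero_iff hX hα0]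
  rcases le_or_gt c (∑ i, VaR P α (X i)) with h | h
  · filter_upwards [hc] with ω hω
    rwa [hω]
  · have h1 : P.real {ω | ∑ i, VaR P α (X i) < total X ω} = 1 := by
      rw [← probReal_univ (μ := P)]
      refine measureReal_congr (eventuallyEq_univ.2 ?_)
      filter_upwards [hc] with ω hω
      simpa [hω] using h
    linarith [measureReal_lt_total_le hX hα0 hα1]

theorem DQ_ES_eq_zero_of_const (hX : ∀ i, Integrable (X i) P) (hα0 : 0 < α) (hα1 : α < 1)
    {c : ℝ} (hc : ∀ᵐ ω ∂P, total X ω = c) : DQ (ES P) α X = 0 := by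
  have hS := integrable_total hX
  rw [DQ_ES_eq_zero_iff hX hα0]
  have hle : VaR P α (total X) ≤ ∑ i, ES P α (X i) :=
    (VaR_le_ES hS hα0 hα1).trans (ES_total_le hX hα0 hα1)
  have hcle : c ≤ VaR P α (total X) := by
    by_contra! h
    have h1 : P.real {ω | VaR P α (total X) < total X ω} = 1 := by
      rw [← probReal_univ (μ := P)]
      refine measureReal_congr (eventuallyEq_univ.2 ?_)
      filter_upwards [hc] with ω hω
      simpa [hω] using h
    linarith [measureReal_VaR_lt hS.aemeasurable hα0 hα1]
  filter_upwards [hc] with ω hω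
  rw [hω]
  exact hcle.trans hle

end Total

/-! ### Tail events -/

section TailEvent

variable {Ω : Type*} [MeasurableSpace Ω] {P : Measure Ω} {X : Ω → ℝ} {A : Set Ω}

/-- Up to null sets, a tail event is nested with every upper level set: one of the two contains
the other. -/
theorem IsTailEvent.ae_or (h : IsTailEvent P X A) {p : ℝ → Prop}
    (hp : ∀ x y, x ≤ y → p x → p y) :
    (∀ᵐ ω ∂P, p (X ω) → ω ∈ A) ∨ (∀ᵐ ω ∂P, ω ∈ A → p (X ω)) := by
  by_cases hc : ∀ᵐ ω ∂P, p (X ω) → ω ∈ A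
  · exact Or.inl hc
  · right
    have hfreq : ∃ᶠ ω in ae P, ¬(p (X ω) → ω ∈ A) := not_eventually.1 hc
    filter_upwards [h.2.2.2] with ω hω hωA
    obtain ⟨ω', h1, h2⟩ := (hfreq.and_eventually hω).exists
    rw [Classical.not_imp] at h1
    exact hp _ _ (h2 hωA h1.2) h1.1

variable [IsProbabilityMeasure P]

theorem IsTailEvent.ae_mem_of_upper (h : IsTailEvent P X A) {p : ℝ → Prop}
    (hp : ∀ x y, x ≤ y → p x → p y) (hle : P.real {ω | p (X ω)} ≤ P.real A) :
    ∀ᵐ ω ∂P, p (X ω) → ω ∈ A := by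
  refine (h.ae_or hp).elim id fun h' => ?_
  have hle' : P {ω | p (X ω)} ≤ P A :=
    (ENNReal.toReal_le_toReal (measure_ne_top _ _) (measure_ne_top _ _)).1 hle
  have heq : A =ᵐ[P] {ω | p (X ω)} :=
    ae_eq_of_ae_subset_of_measure_ge h' hle' h.1.nullMeasurableSet (measure_ne_top _ _)
  filter_upwards [heq.mem_iff] with ω hω hpω
  exact hω.2 hpω

theorem IsTailEvent.ae_upper_of_mem (h : IsTailEvent P X A) {p : ℝ → Prop}
    (hp : ∀ x y, x ≤ y → p x → p y) (hmeas : NullMeasurableSet {ω | p (X ω)} P)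
    (hle : P.real A ≤ P.real {ω | p (X ω)}) : ∀ᵐ ω ∂P, ω ∈ A → p (X ω) := by
  refine (h.ae_or hp).elim (fun h' => ?_) id
  have hle' : P A ≤ P {ω | p (X ω)} :=
    (ENNReal.toReal_le_toReal (measure_ne_top _ _) (measure_ne_top _ _)).1 hle
  have heq : {ω | p (X ω)} =ᵐ[P] A :=
    ae_eq_of_ae_subset_of_measure_ge h' hle' hmeas (measure_ne_top _ _)
  filter_upwards [heq.mem_iff] with ω hω hA
  exact hω.2 hA

theorem IsTailEvent.ae_mem_of_VaR_lt (hX : AEMeasurable X P) (h : IsTailEvent P X A) :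
    ∀ᵐ ω ∂P, VaR P (P.real A) X < X ω → ω ∈ A :=
  h.ae_mem_of_upper (p := fun y => VaR P (P.real A) X < y) (fun _ _ hxy hx => hx.trans_le hxy)
    (measureReal_VaR_lt hX h.2.1 h.2.2.1)

theorem IsTailEvent.ae_VaR_le_of_mem (hX : AEMeasurable X P) (h : IsTailEvent P X A) :
    ∀ᵐ ω ∂P, ω ∈ A → VaR P (P.real A) X ≤ X ω := by
  filter_upwards [h.2.2.2] with ω hω hωA
  rw [VaR_le_iff_le hX h.2.1 h.2.2.1, ← probReal_compl_eq_one_sub h.1]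
  refine ENNReal.toReal_mono (measure_ne_top _ _) (measure_mono_ae ?_)
  filter_upwards [hω] with ω' h' hA
  exact h' hωA hA

/-- Expected Shortfall is the average loss over a tail event. -/
theorem IsTailEvent.mul_ES_eq (hX : Integrable X P) (h : IsTailEvent P X A) :
    P.real A * ES P (P.real A) X = ∫ ω in A, X ω ∂P := by
  have hind : (fun ω => max (X ω - VaR P (P.real A) X) 0) =ᵐ[P]
      A.indicator fun ω => X ω - VaR P (P.real A) X := by
    filter_upwards [h.ae_mem_of_VaR_lt hX.aemeasurable, h.ae_VaR_le_of_mem hX.aemeasurable]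
      with ω h1 h2
    by_cases hA : ω ∈ A
    · rw [indicator_of_mem hA, max_eq_left (sub_nonneg.2 (h2 hA))]
    · rw [indicator_of_notMem hA, max_eq_right (sub_nonpos.2 (not_lt.1 (mt h1 hA)))]
  rw [mul_ES_eq_VaR_add hX h.2.1 h.2.2.1, integral_congr_ae hind, integral_indicator h.1,
    integral_sub hX.integrableOn (integrable_const _)]
  simp

/-- If `ES` is flat between `β` and `P A`, then the quantile at level `β` bounds `X` and is
attained almost everywhere on the tail event `A`: by the Rockafellar–Uryasev formula, `X` has no
mass above that quantile, and its average over `A` is at least that quantile. -/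
theorem IsTailEvent.ae_eq_of_ES_le (hX : Integrable X P) (h : IsTailEvent P X A) {β : ℝ}
    (hβ0 : 0 < β) (hβA : β < P.real A) (hflat : ES P β X ≤ ES P (P.real A) X) :
    ∀ᵐ ω ∂P, ω ∈ A → X ω = VaR P β X := by
  have hβ1 := hβA.trans h.2.2.1
  set q := VaR P β X with hq
  have hβ := mul_ES_eq_VaR_add hX hβ0 hβ1
  have hA := mul_ES_le hX h.2.1 h.2.2.1 q
  have hqle : q ≤ ES P β X := VaR_le_ES hX hβ0 hβ1
  have hE : ES P β X ≤ q := by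
    have h1 : P.real A * ES P β X ≤ P.real A * ES P (P.real A) X :=
      mul_le_mul_of_nonneg_left hflat h.2.1.le
    -- Subtracting the formula at level `β` from the bound at level `P A` leaves `(P A - β) q`.
    refine le_of_mul_le_mul_left (a := P.real A - β) ?_ (by linarith)
    rw [← hq] at hβ
    linarith
  have hzero : ∫ ω, max (X ω - q) 0 ∂P = 0 := by
    rw [le_antisymm hE hqle, ← hq] at hβ
    linarith
  have hXq : ∀ᵐ ω ∂P, X ω ≤ q := by
    have := (integral_eq_zero_iff_of_nonneg (fun ω => le_max_right _ _)
      (integrable_max_sub hX q)).1 hzero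
    filter_upwards [this] with ω hω
    exact sub_nonpos.1 ((le_max_left _ _).trans_eq hω)
  have hint : Integrable (fun ω => q - X ω) (P.restrict A) :=
    (integrable_const q).sub hX.integrableOn
  have hnonneg : 0 ≤ᵐ[P.restrict A] fun ω => q - X ω :=
    ae_restrict_of_ae (hXq.mono fun ω hω => sub_nonneg.2 hω)
  have hle : ∫ ω in A, (q - X ω) ∂P ≤ 0 := by
    rw [integral_sub (integrable_const q) hX.integrableOn, ← h.mul_ES_eq hX]
    have := mul_le_mul_of_nonneg_left (hqle.trans hflat) h.2.1.le
    simpa using this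
  have h0 := (integral_eq_zero_iff_of_nonneg_ae hnonneg hint).1
    (hle.antisymm (integral_nonneg_of_ae hnonneg))
  filter_upwards [(ae_restrict_iff' h.1).1 h0] with ω hω hωA
  exact (sub_eq_zero.1 (hω hωA)).symm

end TailEvent

/-! ### Portfolios with a common tail event -/

section Concentrated

variable {Ω : Type*} [MeasurableSpace Ω] {P : Measure Ω} {n : ℕ} {X : Fin n → Ω → ℝ} {A : Set Ω}

theorem IsTailEvent.total (hn : 0 < n) (h : ∀ i, IsTailEvent P (X i) A) :
    IsTailEvent P (total X) A := by
  obtain ⟨hA, h0, h1, -⟩ := h ⟨0, hn⟩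
  refine ⟨hA, h0, h1, ?_⟩
  filter_upwards [ae_all_iff.2 fun i => (h i).2.2.2] with ω hω
  filter_upwards [ae_all_iff.2 hω] with ω' hω' h1 h2
  exact Finset.sum_le_sum fun i _ => hω' i h1 h2

variable [IsProbabilityMeasure P]

theorem ES_total_eq (hX : ∀ i, Integrable (X i) P) (hn : 0 < n)
    (h : ∀ i, IsTailEvent P (X i) A) :
    ES P (P.real A) (total X) = ∑ i, ES P (P.real A) (X i) := by
  have hS := IsTailEvent.total hn h
  refine mul_left_cancel₀ hS.2.1.ne' ?_
  rw [hS.mul_ES_eq (integrable_total hX), Finset.mul_sum]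
  simp only [Risk.total]
  rw [integral_finsetSum _ fun i _ => (hX i).integrableOn]
  exact Finset.sum_congr rfl fun i _ => ((h i).mul_ES_eq (hX i)).symm

theorem ae_mem_of_lt_total (hX : ∀ i, AEMeasurable (X i) P) (h : ∀ i, IsTailEvent P (X i) A) :
    ∀ᵐ ω ∂P, ∑ i, VaR P (P.real A) (X i) < total X ω → ω ∈ A := by
  filter_upwards [ae_all_iff.2 fun i => (h i).ae_mem_of_VaR_lt (hX i)] with ω hω hlt
  obtain ⟨i, -, hi⟩ := Finset.exists_lt_of_sum_lt (show _ < ∑ i, X i ω from hlt)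
  exact hω i hi

theorem VaR_total_le (hX : ∀ i, AEMeasurable (X i) P) (hn : 0 < n)
    (h : ∀ i, IsTailEvent P (X i) A) :
    VaR P (P.real A) (total X) ≤ ∑ i, VaR P (P.real A) (X i) := by
  obtain ⟨-, h0, h1, -⟩ := h ⟨0, hn⟩
  rw [VaR_le_iff (aemeasurable_total hX) h0 h1]
  exact ENNReal.toReal_mono (measure_ne_top _ _) (measure_mono_ae (ae_mem_of_lt_total hX h))

/-- For `β < P A` the event `{∑ X_i ≤ VaR_β(∑ X_i)}` is too likely to avoid `A`, and on `A` every
`X_i` is at least its quantile; left continuity passes this to `β = P A`. -/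
theorem le_VaR_total (hX : ∀ i, AEMeasurable (X i) P) (hn : 0 < n)
    (h : ∀ i, IsTailEvent P (X i) A) (hcont : LeftCont (VaR P) (P.real A) (total X)) :
    ∑ i, VaR P (P.real A) (X i) ≤ VaR P (P.real A) (total X) := by
  obtain ⟨hA, h0, h1, -⟩ := h ⟨0, hn⟩
  have hS := aemeasurable_total hX
  have hne : (𝓝[<] (P.real A)).NeBot := inferInstance
  refine ge_of_tendsto (hcont.mono Iio_subset_Iic_self) ?_
  filter_upwards [Ioo_mem_nhdsLT h0] with β hβ
  by_contra! hlt
  have hsub : ∀ᵐ ω ∂P, total X ω ≤ VaR P β (total X) → ω ∈ Aᶜ := by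
    filter_upwards [ae_all_iff.2 fun i => (h i).ae_VaR_le_of_mem (hX i)] with ω hω hle hωA
    exact absurd (hlt.trans_le (Finset.sum_le_sum fun i _ => hω i hωA)) (not_lt.2 hle)
  have h2 := (VaR_le_iff_le hS hβ.1 (hβ.2.trans h1)).1 le_rfl
  have h3 : P.real {ω | total X ω ≤ VaR P β (total X)} ≤ P.real Aᶜ :=
    ENNReal.toReal_mono (measure_ne_top _ _) (measure_mono_ae hsub)
  rw [probReal_compl_eq_one_sub hA] at h3
  linarith [hβ.2]

end Concentrated

/-! ### Concentration-exclusion models -/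

section ConcentrationExclusion

variable {Ω : Type*} [MeasurableSpace Ω] {P : Measure Ω} [IsProbabilityMeasure P] {n : ℕ}
  {X : Fin n → Ω → ℝ} {α : ℝ}

theorem IsCE.ae_mem_of_VaR_lt (hn : 0 < n) (hα0 : 0 < α) (h : IsCE P α X) {A : Set Ω}
    (hA : P.real A = n * α) (htail : ∀ i, IsTailEvent P (X i) A) (i : Fin n) :
    ∀ᵐ ω ∂P, VaR P α (X i) < X i ω → ω ∈ A := by
  have hnα : α ≤ n * α := le_mul_of_one_le_left hα0.le (by exact_mod_cast hn)
  refine (htail i).ae_mem_of_upper (p := fun y => VaR P α (X i) < y)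
    (fun _ _ hxy hx => hx.trans_le hxy) ?_
  rwa [h.prob_gt i, hA]

/-- In a concentration-exclusion model the `n` disjoint events `{X_i > VaR_α(X_i)}` fill the
common tail event, and no component is below its quantile there. -/
theorem IsCE.le_measureReal_lt_total (hX : ∀ i, AEMeasurable (X i) P) (hn : 0 < n) (hα0 : 0 < α)
    (h : IsCE P α X) : n * α ≤ P.real {ω | ∑ i, VaR P α (X i) < total X ω} := by
  obtain ⟨A, hA, htail⟩ := h.concentrated
  have hmem := fun i => h.ae_mem_of_VaR_lt hn hα0 hA htail i
  have hge : ∀ i, ∀ᵐ ω ∂P, ω ∈ A → VaR P α (X i) ≤ X i ω := fun i =>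
    (htail i).ae_upper_of_mem (p := fun y => VaR P α (X i) ≤ y) (fun _ _ hxy hx => hx.trans hxy)
      (nullMeasurableSet_le aemeasurable_const (hX i)) (by rw [hA]; exact h.prob_ge i)
  have hsum : P.real (⋃ i ∈ (Finset.univ : Finset (Fin n)), {ω | VaR P α (X i) < X i ω}) =
      n * α := by
    rw [measureReal_biUnion_finset₀ (fun i _ j _ hij => h.exclusive i j hij)
      fun i _ => nullMeasurableSet_lt aemeasurable_const (hX i)]
    simp [h.prob_gt]
  rw [← hsum]
  refine ENNReal.toReal_mono (measure_ne_top _ _) (measure_mono_ae ?_)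
  filter_upwards [ae_all_iff.2 hmem, ae_all_iff.2 hge] with ω h1 h2 hω
  obtain ⟨i, -, hi⟩ := mem_iUnion₂.1 hω
  have hωA := h1 i hi
  exact Finset.sum_lt_sum (fun j _ => h2 j hωA) ⟨i, Finset.mem_univ i, hi⟩

theorem IsCE.DQ_VaR_eq (hX : ∀ i, AEMeasurable (X i) P) (hn : 0 < n) (hα0 : 0 < α) (hα1 : α < 1)
    (h : IsCE P α X) : DQ (VaR P) α X = n := by
  rw [DQ, alphaStar_VaR_eq hX, div_eq_iff hα0.ne']
  exact (measureReal_lt_total_le hX hα0 hα1).antisymm (h.le_measureReal_lt_total hX hn hα0)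

theorem IsCE.DQ_ES_eq_one (hX : ∀ i, Integrable (X i) P) (hn : 0 < n) (hα0 : 0 < α)
    (h : IsCE P α X)
    (hconst : ¬ ∃ c : ℝ, ∀ᵐ ω ∂P, ∑ i, VaR P α (X i) < total X ω → total X ω = c) :
    DQ (ES P) (n * α) X = 1 := by
  obtain ⟨A, hA, htail⟩ := h.concentrated
  have hS := IsTailEvent.total hn htail
  rw [← hA]
  refine DQ_eq_one_of_eq hS.2.1 hS.2.2.1 (ES_total_eq hX hn htail) fun β hβ0 hβA => ?_
  by_contra! hle
  have hmem := fun i => h.ae_mem_of_VaR_lt hn hα0 hA htail i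
  refine hconst ⟨VaR P β (total X), ?_⟩
  filter_upwards [hS.ae_eq_of_ES_le (integrable_total hX) hβ0 hβA hle, ae_all_iff.2 hmem]
    with ω h1 h2 hlt
  obtain ⟨i, -, hi⟩ := Finset.exists_lt_of_sum_lt (show _ < ∑ i, X i ω from hlt)
  exact h1 (h2 i hi)

end ConcentrationExclusion

/-! ### Attaining every value -/

section Indicator

variable {Ω : Type*} [MeasurableSpace Ω] {P : Measure Ω} [IsProbabilityMeasure P] {A : Set Ω}
  {α c : ℝ}

theorem VaR_indicator_eq_zero (hA : MeasurableSet A) (hα0 : 0 < α) (hα1 : α < 1)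
    (h : P.real A ≤ α) (hc : 0 ≤ c ∨ P.real A < 1 - α) :
    VaR P α (A.indicator fun _ => c) = 0 := by
  have hm : AEMeasurable (A.indicator fun _ => c) P :=
    (measurable_const.indicator hA).aemeasurable
  refine le_antisymm ?_ ?_
  · rw [VaR_le_iff hm hα0 hα1]
    refine (measureReal_mono fun ω hω => ?_).trans h
    by_contra hωA
    exact absurd (indicator_of_notMem hωA _) (show (0 : ℝ) < _ from hω).ne'
  · refine le_of_forall_lt fun x hx => ?_
    by_contra! hle
    rw [VaR_le_iff_le hm hα0 hα1] at hle
    rcases hc with hc | hc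
    · have hempty : {ω | A.indicator (fun _ => c) ω ≤ x} = ∅ :=
        eq_empty_of_forall_notMem fun ω hω =>
          absurd (indicator_nonneg (fun _ _ => hc) ω) (not_le.2 (lt_of_le_of_lt hω hx))
      rw [hempty, measureReal_empty] at hle
      linarith
    · have hsub : {ω | A.indicator (fun _ => c) ω ≤ x} ⊆ A := fun ω hω => by
        by_contra hωA
        exact absurd (indicator_of_notMem hωA _) (ne_of_lt (lt_of_le_of_lt hω hx))
      linarith [measureReal_mono (μ := P) hsub]

theorem mul_ES_indicator (hA : MeasurableSet A) (hα0 : 0 < α) (hα1 : α < 1)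
    (h : P.real A ≤ α) (hc : 0 ≤ c ∨ P.real A < 1 - α) :
    α * ES P α (A.indicator fun _ => c) = max c 0 * P.real A := by
  rw [mul_ES_eq_VaR_add ((integrable_const c).indicator hA) hα0 hα1,
    VaR_indicator_eq_zero hA hα0 hα1 h hc]
  have hfun : (fun ω => max (A.indicator (fun _ => c) ω - 0) 0) =
      A.indicator fun _ => max c 0 := by
    ext ω
    by_cases hω : ω ∈ A <;> simp [hω]
  rw [hfun, integral_indicator_const _ hA]
  simp [mul_comm]

/-- Disjoint events of probability `d α / n` realise the diversification quotient `d` for `VaR`: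
their indicators have quantile `0`, and their sum is positive with probability `d α`. -/
theorem exists_DQ_VaR_eq (hP : Atomless P) {n : ℕ} (hn : 0 < n) (hα0 : 0 < α) (hα1 : α < 1)
    {d : ℝ} (hd0 : 0 ≤ d) (hdn : d ≤ n) (hdα : d ≤ 1 / α) :
    ∃ X : Fin n → Ω → ℝ, (∀ i, AEMeasurable (X i) P) ∧ DQ (VaR P) α X = d := by
  have hn' : (0 : ℝ) < n := by exact_mod_cast hn
  have hdα' : d * α ≤ 1 := (le_div_iff₀ hα0).1 hdα
  have hnq : n * (d * α / n) = d * α := mul_div_cancel₀ _ hn'.ne'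
  obtain ⟨B, hB, hdisj⟩ := hP.exists_pairwise_disjoint n MeasurableSet.univ
    (show 0 ≤ d * α / n by positivity) (by rw [hnq, probReal_univ]; exact hdα')
  have hle : d * α / n ≤ α := (div_le_iff₀ hn').2 (by nlinarith)
  have hm : ∀ i, AEMeasurable ((B i).indicator fun _ => (1 : ℝ)) P := fun i =>
    (measurable_const.indicator (hB i).1).aemeasurable
  refine ⟨fun i => (B i).indicator fun _ => 1, hm, ?_⟩
  rw [DQ, alphaStar_VaR_eq hm, div_eq_iff hα0.ne']
  have hV : ∀ i, VaR P α ((B i).indicator fun _ => (1 : ℝ)) = 0 := fun i =>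
    VaR_indicator_eq_zero (hB i).1 hα0 hα1 ((hB i).2.2.trans_le hle) (Or.inl zero_le_one)
  simp only [hV, Finset.sum_const_zero]
  have hset : {ω | 0 < total (fun i => (B i).indicator fun _ => (1 : ℝ)) ω} = ⋃ i, B i := by
    ext ω
    rw [mem_ofPred_eq, mem_iUnion, total]
    constructor
    · intro hpos
      obtain ⟨i, -, hi⟩ := Finset.exists_lt_of_sum_lt
        (show ∑ i : Fin n, (0 : ℝ) < ∑ i, (B i).indicator (fun _ => (1 : ℝ)) ω by simpa using hpos)
      exact ⟨i, mem_of_indicator_ne_zero hi.ne'⟩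
    · rintro ⟨i, hi⟩
      refine Finset.sum_pos' (fun j _ => indicator_nonneg (fun _ _ => zero_le_one) ω)
        ⟨i, Finset.mem_univ i, ?_⟩
      rw [indicator_of_mem hi]
      exact one_pos
  rw [hset, measureReal_iUnion_fintype hdisj fun i => (hB i).1]
  simp only [(hB _).2.2]
  simpa using hnq

/-- For an event `A` of small probability, the positions `d⁻¹ 1_A` and `(1 - d⁻¹) 1_A`, completed
by zeros, realise the diversification quotient `d` for `ES`: the second one has vanishing `ES` at
level `α`, so the threshold is `P A / (d α)`, while the total loss is `1_A`, whose `ES` at level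
`β` is `min 1 (P A / β)`. -/
theorem exists_DQ_ES_eq (hP : Atomless P) {n : ℕ} (hn : 2 ≤ n) (hα0 : 0 < α) (hα1 : α < 1)
    {d : ℝ} (hd0 : 0 ≤ d) (hd1 : d ≤ 1) :
    ∃ X : Fin n → Ω → ℝ, (∀ i, Integrable (X i) P) ∧ DQ (ES P) α X = d := by
  obtain ⟨m, rfl⟩ : ∃ m, n = m + 2 := ⟨n - 2, by omega⟩
  rcases hd0.eq_or_lt with rfl | hd0
  · exact ⟨fun _ _ => 0, fun _ => integrable_zero _ _ _,
      DQ_ES_eq_zero_of_const (fun _ => integrable_zero _ _ _) hα0 hα1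
        (c := 0) (ae_of_all _ fun ω => by simp [total])⟩
  have hdα : 0 < d * α := mul_pos hd0 hα0
  have hdα_le : d * α ≤ α := mul_le_of_le_one_left hα0.le hd1
  obtain ⟨p, hp0, hp⟩ : ∃ p, 0 < p ∧ p < min (d * α) (1 - α) :=
    exists_between (lt_min hdα (sub_pos.2 hα1))
  obtain ⟨hp1, hp2⟩ := lt_min_iff.1 hp
  obtain ⟨A, hA, -, hAp⟩ := hP.exists_subset_eq MeasurableSet.univ hp0.le
    (by rw [probReal_univ]; linarith)
  let c : Fin (m + 2) → ℝ := Fin.cons (1 / d) (Fin.cons (1 - 1 / d) fun _ => 0)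
  have hc1 : ∑ i, c i = 1 := by simp [c, Fin.sum_univ_succ]
  have hd : 1 ≤ 1 / d := (one_le_div hd0).2 hd1
  have hcmax : ∑ i, max (c i) 0 = 1 / d := by
    have h1 : max (1 / d) 0 = 1 / d := max_eq_left (by linarith)
    have h2 : max (1 - 1 / d) 0 = 0 := max_eq_right (by linarith)
    simp only [c, Fin.sum_univ_succ, Fin.cons_zero, Fin.cons_succ, h1, h2, max_self]
    simp
  have hX : ∀ i, Integrable (A.indicator fun _ => c i) P := fun i =>
    (integrable_const _).indicator hA
  have htotal : total (fun i => A.indicator fun _ => c i) = A.indicator fun _ => (1 : ℝ) := by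
    ext ω
    by_cases hω : ω ∈ A <;> simp [total, hω, hc1]
  have hsum : ∑ i, ES P α (A.indicator fun _ => c i) = p / (d * α) := by
    have h1 : ∀ i, ES P α (A.indicator fun _ => c i) = max (c i) 0 * (p / α) := fun i => by
      have := mul_ES_indicator (c := c i) hA hα0 hα1 (by linarith)
        (Or.inr (by rwa [hAp]))
      rw [hAp] at this
      field_simp
      linarith
    simp only [h1]
    rw [← Finset.sum_mul, hcmax]
    field_simp
  refine ⟨fun i => A.indicator fun _ => c i, hX, ?_⟩
  rw [DQ, div_eq_iff hα0.ne']
  have hES : ∀ β, p ≤ β → β < 1 → β * ES P β (A.indicator fun _ => (1 : ℝ)) = p :=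
    fun β hβ hβ1 => by
      have := mul_ES_indicator (P := P) (c := 1) hA (hp0.trans_le hβ) hβ1 (by linarith)
        (Or.inl zero_le_one)
      simpa [hAp] using this
  refine le_antisymm (alphaStar_le_of_mem ⟨hdα, by linarith, ?_⟩)
    (le_alphaStar (by linarith) fun β hβ => ?_)
  · rw [htotal, hsum, le_div_iff₀' hdα, hES _ hp1.le (by linarith)]
  · obtain ⟨hβ0, hβ1, hle⟩ := hβ
    rw [htotal, hsum] at hle
    rcases le_or_gt p β with hpβ | hpβ
    · have h1 := mul_le_mul_of_nonneg_left hle hβ0.le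
      rw [hES β hpβ hβ1, ← mul_div_assoc, le_div_iff₀ hdα, mul_comm β] at h1
      exact le_of_mul_le_mul_left h1 hp0
    -- Below the level `p` the quantile of `1_A` exceeds the threshold `p / (d α) < 1`.
    · have h1 : p / (d * α) < 1 := (div_lt_one hdα).2 hp1
      have hI : Integrable (A.indicator fun _ => (1 : ℝ)) P := (integrable_const _).indicator hA
      have h2 := (VaR_le_iff hI.aemeasurable hβ0 hβ1).1 ((VaR_le_ES hI hβ0 hβ1).trans hle)
      have hsub : A ⊆ {ω | p / (d * α) < A.indicator (fun _ => (1 : ℝ)) ω} := fun ω hω => by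
        rw [mem_ofPred_eq, indicator_of_mem hω]
        exact h1
      linarith [measureReal_mono (μ := P) hsub]

end Indicator

end Risk

theorem theorem1 {Ω : Type*} [MeasurableSpace Ω] (P : Measure Ω) [IsProbabilityMeasure P]
    (hP : Atomless P) (n : ℕ) (hn : 2 ≤ n) (α : ℝ) (hα0 : 0 < α) (hα1 : α < 1) :
    -- (i) the exact ranges
    ({d : ℝ | ∃ X : Fin n → Ω → ℝ, (∀ i, AEMeasurable (X i) P) ∧ DQ (VaR P) α X = d}
        = Set.Icc 0 (min (n : ℝ) (1 / α)) ∧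
      {d : ℝ | ∃ X : Fin n → Ω → ℝ, (∀ i, Integrable (X i) P) ∧ DQ (ES P) α X = d}
        = Set.Icc 0 1) ∧
    -- (ii) the value 0
    ((∀ X : Fin n → Ω → ℝ, (∀ i, AEMeasurable (X i) P) →
        (DQ (VaR P) α X = 0 ↔ ∀ᵐ ω ∂P, total X ω ≤ ∑ i, VaR P α (X i))) ∧
      (∀ X : Fin n → Ω → ℝ, (∀ i, Integrable (X i) P) →
        (DQ (ES P) α X = 0 ↔ ∀ᵐ ω ∂P, total X ω ≤ ∑ i, ES P α (X i))) ∧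
      (∀ X : Fin n → Ω → ℝ, (∀ i, AEMeasurable (X i) P) →
        (∃ c : ℝ, ∀ᵐ ω ∂P, total X ω = c) → α < 1 / n → DQ (VaR P) α X = 0) ∧
      (∀ X : Fin n → Ω → ℝ, (∀ i, Integrable (X i) P) →
        (∃ c : ℝ, ∀ᵐ ω ∂P, total X ω = c) → DQ (ES P) α X = 0)) ∧
    -- (iii) concentrated vectors
    ((∀ X : Fin n → Ω → ℝ, (∀ i, AEMeasurable (X i) P) → Concentrated P α X →
        DQ (VaR P) α X ≤ 1 ∧
        (LeftCont (VaR P) α (total X) → NonFlatLeft (VaR P) α (total X) →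
          DQ (VaR P) α X = 1)) ∧
      (∀ X : Fin n → Ω → ℝ, (∀ i, Integrable (X i) P) → Concentrated P α X →
        DQ (ES P) α X ≤ 1 ∧
        (LeftCont (ES P) α (total X) → NonFlatLeft (ES P) α (total X) →
          DQ (ES P) α X = 1))) ∧
    -- (iv) concentration-exclusion models
    (α < 1 / n →
      (∀ X : Fin n → Ω → ℝ, (∀ i, AEMeasurable (X i) P) → IsCE P α X →
        DQ (VaR P) α X = n) ∧
      (∀ X : Fin n → Ω → ℝ, (∀ i, Integrable (X i) P) → IsCE P α X →
        -- the total loss is not almost surely constant where it exceeds the sum of the VaRs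
        (¬ ∃ c : ℝ, ∀ᵐ ω ∂P, ∑ i, VaR P α (X i) < total X ω → total X ω = c) →
        DQ (ES P) (n * α) X = 1)) := by
  have hn0 : 0 < n := by omega
  have hn0' : (0 : ℝ) < n := by exact_mod_cast hn0
  have hmul : α < 1 / n → n * α < 1 := fun h => by
    rwa [lt_div_iff₀ hn0', mul_comm] at h
  refine ⟨⟨?_, ?_⟩, ⟨?_, ?_, ?_, ?_⟩, ⟨?_, ?_⟩, fun _ => ⟨?_, ?_⟩⟩
  · ext d
    constructor
    · rintro ⟨X, hX, rfl⟩
      exact ⟨DQ_nonneg hα0, DQ_VaR_le hX hα0 hα1⟩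
    · rintro ⟨h0, h1⟩
      exact exists_DQ_VaR_eq hP hn0 hα0 hα1 h0 (h1.trans (min_le_left _ _))
        (h1.trans (min_le_right _ _))
  · ext d
    constructor
    · rintro ⟨X, hX, rfl⟩
      exact ⟨DQ_nonneg hα0, DQ_ES_le_one hX hα0 hα1⟩
    · rintro ⟨h0, h1⟩
      exact exists_DQ_ES_eq hP hn hα0 hα1 h0 h1
  · exact fun X hX => DQ_VaR_eq_zero_iff hX hα0
  · exact fun X hX => DQ_ES_eq_zero_iff hX hα0
  · exact fun X hX ⟨c, hc⟩ hαn => DQ_VaR_eq_zero_of_const hX hα0 hα1 (hmul hαn) hc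
  · exact fun X hX ⟨c, hc⟩ => DQ_ES_eq_zero_of_const hX hα0 hα1 hc
  · rintro X hX ⟨A, rfl, hA⟩
    have hle := VaR_total_le hX hn0 hA
    exact ⟨DQ_le_one_of_le hα0 hα1 hle, fun hcont hflat =>
      DQ_eq_one_of_eq hα0 hα1 (hle.antisymm (le_VaR_total hX hn0 hA hcont)) hflat⟩
  · rintro X hX ⟨A, rfl, hA⟩
    exact ⟨DQ_ES_le_one hX hα0 hα1, fun _ hflat =>
      DQ_eq_one_of_eq hα0 hα1 (ES_total_eq hX hn0 hA) hflat⟩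
  · exact fun X hX hCE => hCE.DQ_VaR_eq hX hn0 hα0 hα1
  · exact fun X hX hCE hconst => hCE.DQ_ES_eq_one hX hn0 hα0 hconst
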